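/- Let $F\in\mathbf C[x_0,x_1,x_2]$ be a nonzero homogeneous polynomial of degree $5$ (a ternary quintic), with zero scheme $C\subseteq\mathbf P^2$. *Notation for concomitants.* Use symbolic letters $\alpha,\beta,\gamma,\delta$, each with three coordinates, e.g. $\alpha=(\alpha_0,\alpha_1,\alpha_2)$, and two further vectors of variables $x=(x_0,x_1,x_2)$, $u=(u_0,u_1,u_2)$. Put $\alpha_x=\alpha_0x_0+\alpha_1x_1+\alpha_2x_2$, and let $(\alpha\,\beta\,u)$, $(\alpha\,\beta\,\gamma)$ be the $3\times3$ determinants whose rows are the indicated vectors. The symbol $\langle p_1,\dots,p_r\,|\,q_1,\dots,q_r\,|\,\dots\rangle$ denotes the tableau whose first row consists of the first letter $p_1$ times, then the second letter $p_2$ times, and so on, whose second row consists likewise of the letters with multiplicities $q_1,\dots,q_r$, etc.; in total each of the $r$ letters occurs $5$ times. Reading the tableau columnwise gives a product of factors, where a column with entry $\alpha$ contributes $\alpha_x$, a column $\alpha,\beta$ contributes $(\alpha\,\beta\,u)$, and a column $\alpha,\beta,\gamma$ contributes $(\alpha\,\beta\,\gamma)$. The value on $F$ of the corresponding concomitant is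 the polynomial in $x,u$ obtained by applying to this product the differential operators $\frac1{5!}F\bigl(\frac{\partial}{\partial\alpha_0},\frac{\partial}{\partial\alpha_1},\frac{\partial}{\partial\alpha_2}\bigr)$, one for each of the $r$ letters. Sums, products and powers of concomitants are those of their values. **Proposition.** $C$ consists of a triple line and a double line (that is, $C=3\ell_1+2\ell_2$ as a divisor for some lines $\ell_1,\ell_2$, possibly equal; equivalently $F=L_1^3L_2^2$ for some linear forms $L_1,L_2$) if and only if the following seven concomitants of degree $3$ and four concomitants of degree $4$ all vanish identically on $F$: $$\begin{array}{lll} \langle5,4,1|0,1,3|0,0,1\rangle, & \langle5,3,3|0,2,0|0,0,2\rangle, & \langle5,3,0|0,2,4|0,0,1\rangle,\\ \langle5,3,1|0,2,2|0,0,2\rangle, & \langle5,2,1|0,3,2|0,0,2\rangle, & \langle5,1,0|0,4,2|0,0,3\rangle,\\ \langle5,1,1|0,4,0|0,0,4\rangle; & & \end{array}$$ $$\begin{array}{l} 50\,\langle5,3,4,4|0,2,1,1\rangle-19\,\langle5,1,5,5|0,4,0,0\rangle,\\ 5\,\langle5,5,4,0|0,0,1,5\rangle-8\,\langle5,4,0,5|0,1,5,0\rangle,\\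 \langle5,1|0,4\rangle^2+2\,\langle5,3,2,2|0,2,3,3\rangle,\\ \langle5,3,2,0|0,2,3,5\rangle. \end{array}$$ -/

import Mathlib

noncomputable section

namespace TernaryQuintic

open MvPolynomial

/-! ### Zero schemes in the projective plane -/

/-- A closed subscheme of the complex projective plane with homogeneous coordinates
`x₀, x₁, x₂`, recorded by its ideals on the three standard affine charts `xᵢ ≠ 0`. The chart
`xᵢ ≠ 0` is the affine plane whose coordinates are the `xⱼ / xᵢ`, `j ≠ i`. The product is
chartwise: it is the product of ideal sheaves, that is, the sum of effective Cartier divisors. -/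
abbrev ChartIdeals : Type := (i : Fin 3) → Ideal (MvPolynomial {j : Fin 3 // j ≠ i} ℂ)

/-- Restriction of a form to the chart `xᵢ ≠ 0`: put `xᵢ = 1`. -/
def dehomogenize (i : Fin 3) :
    MvPolynomial (Fin 3) ℂ →ₐ[ℂ] MvPolynomial {j : Fin 3 // j ≠ i} ℂ :=
  aeval fun j => if h : j = i then 1 else X ⟨j, h⟩

/-- The zero scheme in the projective plane of a form `F`. -/
def zeroScheme (F : MvPolynomial (Fin 3) ℂ) : ChartIdeals :=
  fun i => Ideal.span {dehomogenize i F}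

/-- `C` is the sum `3 ℓ₁ + 2 ℓ₂` of a triple line and a double line. The lines `ℓ₁`, `ℓ₂`
are the zero schemes of nonzero linear forms; they are allowed to coincide. -/
def IsTripleLinePlusDoubleLine (C : ChartIdeals) : Prop :=
  ∃ L₁ L₂ : MvPolynomial (Fin 3) ℂ,
    L₁.IsHomogeneous 1 ∧ L₁ ≠ 0 ∧ L₂.IsHomogeneous 1 ∧ L₂ ≠ 0 ∧
      C = zeroScheme L₁ ^ 3 * zeroScheme L₂ ^ 2

/-! ### Symbolic expressions -/

/-- Polynomials in the point coordinates `x₀, x₁, x₂` (the variables `Sum.inl i`) and the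
line coordinates `u₀, u₁, u₂` (the variables `Sum.inr i`). -/
abbrev XU : Type := MvPolynomial (Fin 3 ⊕ Fin 3) ℂ

/-- Polynomials in the coordinates of `r` symbolic letters, with coefficients in `XU`;
the variable `(a, i)` is the `i`-th coordinate of the letter `a`. -/
abbrev Symbolic (r : ℕ) : Type := MvPolynomial (Fin r × Fin 3) XU

variable {m r : ℕ}

/-- The coordinate vector of the letter `a`. -/
def letter (a : Fin r) : Fin 3 → Symbolic r := fun i => X (a, i)

/-- The coordinate vector `x`. -/
def xVec : Fin 3 → Symbolic r := fun i => C (X (Sum.inl i))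

/-- The coordinate vector `u`. -/
def uVec : Fin 3 → Symbolic r := fun i => C (X (Sum.inr i))

/-- The symbolic bracket `(v w z)`: the determinant with rows `v`, `w`, `z`. -/
def bracket (v w z : Fin 3 → Symbolic r) : Symbolic r := (Matrix.of ![v, w, z]).det

/-- The symbolic factor read off from one column of a tableau: `αₓ = ∑ αᵢ xᵢ` for the column
`α`, `(α β u)` for the column `α, β`, and `(α β γ)` for the column `α, β, γ`. -/
def columnFactor : List (Fin r) → Symbolic r
  | [a] => ∑ i, letter a i * xVec i
  | [a, b] => bracket (letter a) (letter b) uVec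
  | [a, b, c] => bracket (letter a) (letter b) (letter c)
  | _ => 1

/-- The `i`-th row of the tableau whose `i`-th row contains the letter `k` exactly `T i k` times,
the letters of each row being in increasing order. -/
def tableauRow (T : Matrix (Fin m) (Fin r) ℕ) (i : Fin m) : List (Fin r) :=
  (List.finRange r).flatMap fun k => List.replicate (T i k) k

/-- The `j`-th column of this tableau, from top to bottom. -/
def tableauColumn (T : Matrix (Fin m) (Fin r) ℕ) (j : ℕ) : List (Fin r) :=
  (List.finRange m).filterMap fun i => (tableauRow T i)[j]?

/-- The number of columns of this tableau. -/
def tableauWidth (T : Matrix (Fin m) (Fin r) ℕ) : ℕ :=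
  Finset.univ.sup fun i => ∑ k, T i k

/-- The symbolic expression obtained by reading the tableau columnwise. -/
def tableauSymbol (T : Matrix (Fin m) (Fin r) ℕ) : Symbolic r :=
  ∏ j ∈ Finset.range (tableauWidth T), columnFactor (tableauColumn T j)

/-! ### Concomitants -/

/-- The differential operator `(1 / 5!) F(∂/∂a₀, ∂/∂a₁, ∂/∂a₂)` in the coordinates of the
letter `a`, attached to a ternary quintic `F`. -/
def letterIntegral (F : MvPolynomial (Fin 3) ℂ) (a : Fin r) (G : Symbolic r) : Symbolic r :=
  (1 / (Nat.factorial 5 : ℂ)) • ∑ e ∈ F.support, F.coeff e •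
    (pderiv (a, 0))^[e 0] ((pderiv (a, 1))^[e 1] ((pderiv (a, 2))^[e 2] G))

/-- The value on the quintic `F` of the concomitant with the symbolic expression `G`. The
operators of all the letters are applied to `G`. When `G` has degree five in each letter,
the result involves no letter any more, and `constantCoeff` just views it as a polynomial
in `x` and `u`. -/
def symbolicValue (F : MvPolynomial (Fin 3) ℂ) (G : Symbolic r) : XU :=
  constantCoeff ((List.finRange r).foldr (letterIntegral F) G)

/-- The concomitant `⟨T 0 0, T 0 1, … | T 1 0, T 1 1, … | …⟩`, evaluated on `F`. -/
def concomitant (T : Matrix (Fin m) (Fin r) ℕ) (F : MvPolynomial (Fin 3) ℂ) : XU :=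
  symbolicValue F (tableauSymbol T)

/-- The seven concomitants of degree three. -/
def cov3 : List (MvPolynomial (Fin 3) ℂ → XU) :=
  [ concomitant !![5, 4, 1; 0, 1, 3; 0, 0, 1],
    concomitant !![5, 3, 3; 0, 2, 0; 0, 0, 2],
    concomitant !![5, 3, 0; 0, 2, 4; 0, 0, 1],
    concomitant !![5, 3, 1; 0, 2, 2; 0, 0, 2],
    concomitant !![5, 2, 1; 0, 3, 2; 0, 0, 2],
    concomitant !![5, 1, 0; 0, 4, 2; 0, 0, 3],
    concomitant !![5, 1, 1; 0, 4, 0; 0, 0, 4] ]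

/-- The four concomitants of degree four. -/
def cov4 : List (MvPolynomial (Fin 3) ℂ → XU) :=
  [ fun F => 50 * concomitant !![5, 3, 4, 4; 0, 2, 1, 1] F
      - 19 * concomitant !![5, 1, 5, 5; 0, 4, 0, 0] F,
    fun F => 5 * concomitant !![5, 5, 4, 0; 0, 0, 1, 5] F
      - 8 * concomitant !![5, 4, 0, 5; 0, 1, 5, 0] F,
    fun F => concomitant !![5, 1; 0, 4] F ^ 2
      + 2 * concomitant !![5, 3, 2, 2; 0, 2, 3, 3] F,
    concomitant !![5, 3, 2, 0; 0, 2, 3, 5] ]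

end TernaryQuintic

end

noncomputable section

namespace TernaryQuintic

open MvPolynomial

/-! ### Symbolic differentiation -/

variable {r : ℕ}

/-! Everything reduces to sums of fifth powers. By polarization every quintic is `F = ∑ cᵢ lᵢ⁵`
(`exists_sum_linForm_pow`). The operator `(1/5!) lᵢ(∂)⁵`, applied to an expression of degree five in
a letter, substitutes `lᵢ` for that letter. The value of a concomitant at numerical `x`, `u` is
therefore a weighted sum, over all assignments of the `lᵢ` to the letters, of the product of the
column factors (`eval_concomitant`).

For `F = L₁³L₂²`, the `lᵢ` can be taken in the pencil spanned by `L₁` and `L₂`. Brackets of three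
letters then vanish, which kills the concomitants of degree three. The brackets `(lᵢ lⱼ u)` become
differences of pencil parameters times one common factor, and the relations of degree four become
polynomial identities (`cov3_linForm`, `cov4_linForm`).

The converse comes from the first concomitant of degree four. At a zero `x` of `F`, put `u = x × y`.
The subtracted term contains `F(x)²` and drops out, and the other one equals `-2 M⁴` up to the
factor 50, where `5M` is the derivative of `F` at `x` along `y` (`sum_moment_identity`). So all
zeros of `F` are singular. By the Nullstellensatz every irreducible factor is repeated
(`sq_dvd_of_irreducible_dvd`), and in degree five this leaves only a fifth power of a linear factor,
or a cube times a square of linear factors (`exists_eq_cube_mul_sq`). -/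

/-- The linear form with coefficient vector `v`. -/
def linForm (v : Fin 3 → ℂ) : MvPolynomial (Fin 3) ℂ := ∑ i, C (v i) * X i

/-- Partial differentiation with respect to a coordinate of a letter, as a `ℂ`-linear map. -/
def letterDeriv (a : Fin r) (i : Fin 3) : Module.End ℂ (Symbolic r) :=
  (pderiv (R := XU) (a, i)).toLinearMap.restrictScalars ℂ

@[simp]
lemma letterDeriv_apply (a : Fin r) (i : Fin 3) (G : Symbolic r) :
    letterDeriv a i G = pderiv (a, i) G := rfl

/-- The commutator of two derivations is again a derivation, and this one kills every variable. -/
lemma pderiv_comm {σ R : Type*} [CommRing R] (i j : σ) (p : MvPolynomial σ R) :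
    pderiv i (pderiv j p) = pderiv j (pderiv i p) := by
  have h : ⁅pderiv (R := R) i, pderiv (R := R) j⁆ = 0 := by
    classical
    ext k
    simp [Derivation.commutator_apply, pderiv_X, Pi.single_apply, apply_ite]
  have := congrArg (fun D => D p) h
  simpa [Derivation.commutator_apply, sub_eq_zero] using this

lemma letterDeriv_commute (a : Fin r) (i j : Fin 3) :
    Commute (letterDeriv a i) (letterDeriv a j) :=
  LinearMap.ext fun G => pderiv_comm (a, i) (a, j) G

/-- The constant coefficient differential operator `F(∂/∂a₀, ∂/∂a₁, ∂/∂a₂)`. -/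
def letterOp (a : Fin r) : MvPolynomial (Fin 3) ℂ →ₗ[ℂ] Module.End ℂ (Symbolic r) :=
  (basisMonomials (Fin 3) ℂ).constr ℂ fun e =>
    letterDeriv a 0 ^ e 0 * letterDeriv a 1 ^ e 1 * letterDeriv a 2 ^ e 2

lemma letterOp_monomial (a : Fin r) (e : Fin 3 →₀ ℕ) (c : ℂ) :
    letterOp a (monomial e c) =
      c • (letterDeriv a 0 ^ e 0 * letterDeriv a 1 ^ e 1 * letterDeriv a 2 ^ e 2) := by
  have h : (monomial e c : MvPolynomial (Fin 3) ℂ) = c • basisMonomials (Fin 3) ℂ e := by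
    simp [smul_monomial]
  rw [h, map_smul, letterOp, Module.Basis.constr_basis]

lemma letterIntegral_eq (F : MvPolynomial (Fin 3) ℂ) (a : Fin r) (G : Symbolic r) :
    letterIntegral F a G = (1 / (Nat.factorial 5 : ℂ)) • letterOp a F G := by
  conv_rhs => rw [F.as_sum, map_sum]
  rw [letterIntegral, LinearMap.sum_apply]
  congr 1
  refine Finset.sum_congr rfl fun e _ => ?_
  rw [letterOp_monomial, LinearMap.smul_apply, Module.End.mul_apply, Module.End.mul_apply,
    Module.End.pow_apply, Module.End.pow_apply, Module.End.pow_apply]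
  rfl

/-- `letterOp` writes the partial derivatives in a fixed order, so commutation is what lets the new
factor move to its place. This gives the multiplicativity of `F ↦ F(∂)` that is needed to compute
the operator of a power of a linear form. -/
lemma letterOp_X_mul (a : Fin r) (i : Fin 3) (F : MvPolynomial (Fin 3) ℂ) :
    letterOp a (X i * F) = letterDeriv a i * letterOp a F := by
  induction F using MvPolynomial.induction_on' with
  | add p q hp hq => rw [mul_add, map_add, map_add, hp, hq, mul_add]
  | monomial e c =>
    have h : (X i * monomial e c : MvPolynomial (Fin 3) ℂ) =
        monomial (Finsupp.single i 1 + e) c := by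
      rw [X, monomial_mul, one_mul]
    rw [h, letterOp_monomial, letterOp_monomial, mul_smul_comm]
    congr 1
    have h01 := letterDeriv_commute a 1 0
    have h02 := letterDeriv_commute a 2 0
    have h12 := letterDeriv_commute a 2 1
    fin_cases i
    · simp [pow_add, mul_assoc]
    · simp [pow_add, ← mul_assoc, (h01.pow_right _).eq]
    · simp [pow_add, ← mul_assoc, (h02.pow_right _).eq]
      rw [mul_assoc (letterDeriv a 0 ^ e 0) (letterDeriv a 2), (h12.pow_right _).eq, ← mul_assoc]

/-- The directional derivative in the coordinates of the letter `a` along `v`. -/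
def dirDeriv (a : Fin r) (v : Fin 3 → ℂ) : Module.End ℂ (Symbolic r) :=
  ∑ i, v i • letterDeriv a i

lemma dirDeriv_mul (a : Fin r) (v : Fin 3 → ℂ) (G H : Symbolic r) :
    dirDeriv a v (G * H) = G * dirDeriv a v H + dirDeriv a v G * H := by
  simp only [dirDeriv, LinearMap.sum_apply, LinearMap.smul_apply, letterDeriv_apply,
    Derivation.leibniz, smul_eq_mul, Finset.mul_sum, Finset.sum_mul, ← Finset.sum_add_distrib]
  refine Finset.sum_congr rfl fun i _ => ?_
  rw [smul_add, mul_smul_comm, smul_mul_assoc, mul_comm H]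

lemma letterOp_linForm_mul (a : Fin r) (v : Fin 3 → ℂ) (F : MvPolynomial (Fin 3) ℂ) :
    letterOp a (linForm v * F) = dirDeriv a v * letterOp a F := by
  simp only [linForm, dirDeriv, Finset.sum_mul, map_sum]
  refine Finset.sum_congr rfl fun i _ => ?_
  rw [mul_assoc, ← smul_eq_C_mul, map_smul, letterOp_X_mul, smul_mul_assoc]

lemma letterOp_one (a : Fin r) : letterOp a 1 = 1 := by
  rw [← C_1, C_apply, letterOp_monomial]; simp

lemma letterOp_linForm_pow (a : Fin r) (v : Fin 3 → ℂ) (n : ℕ) :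
    letterOp a (linForm v ^ n) = dirDeriv a v ^ n := by
  induction n with
  | zero => simp [letterOp_one]
  | succ n ih => rw [pow_succ', letterOp_linForm_mul, ih, pow_succ']

/-- Substitution of the vector `v` for the letter `a`. -/
def letterSubst (a : Fin r) (v : Fin 3 → ℂ) : Symbolic r →ₐ[XU] Symbolic r :=
  aeval fun p => if p.1 = a then C (C (v p.2)) else X p

/-- The weights defining the degree in the coordinates of the letter `a`. -/
def letterWeight (a : Fin r) : Fin r × Fin 3 → ℕ := fun p => if p.1 = a then 1 else 0

/-- `G` is homogeneous of degree `n` in the letter `a`. -/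
abbrev HasLetterDegree (a : Fin r) (n : ℕ) (G : Symbolic r) : Prop :=
  IsWeightedHomogeneous (letterWeight a) G n

lemma dirDeriv_C (a : Fin r) (v : Fin 3 → ℂ) (c : XU) : dirDeriv a v (C c) = 0 := by
  simp [dirDeriv]

lemma dirDeriv_X (a : Fin r) (v : Fin 3 → ℂ) (p : Fin r × Fin 3) :
    dirDeriv a v (X p) = if p.1 = a then C (C (v p.2)) else 0 := by
  obtain ⟨b, j⟩ := p
  simp only [dirDeriv, LinearMap.sum_apply, LinearMap.smul_apply, letterDeriv_apply, pderiv_X,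
    Pi.single_apply, Prod.mk.injEq]
  by_cases h : b = a
  · subst h
    simp only [true_and, if_true, smul_ite, smul_zero, Finset.sum_ite_eq, Finset.mem_univ]
    rw [Algebra.smul_def, mul_one]; rfl
  · simp [h]

/-- Leibniz' formula for a higher derivative stops after two terms when the second derivative of `H`
vanishes. It is applied with `H` a variable. -/
lemma dirDeriv_pow_succ_mul (a : Fin r) (v : Fin 3 → ℂ) {H : Symbolic r}
    (hH : dirDeriv a v (dirDeriv a v H) = 0) (G : Symbolic r) (n : ℕ) :
    (dirDeriv a v ^ (n + 1)) (H * G) =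
      H * (dirDeriv a v ^ (n + 1)) G + (n + 1) * dirDeriv a v H * (dirDeriv a v ^ n) G := by
  induction n with
  | zero => simp [dirDeriv_mul]
  | succ n ih =>
    have hc : ∀ K : Symbolic r, dirDeriv a v (((n : Symbolic r) + 1) * K) =
        ((n : Symbolic r) + 1) * dirDeriv a v K := by
      intro K
      have : ((n : Symbolic r) + 1) = C ((n : XU) + 1) := by simp
      rw [dirDeriv_mul, this, dirDeriv_C, zero_mul, add_zero]
    have hs : ∀ (k : ℕ) (K : Symbolic r), (dirDeriv a v ^ (k + 1)) K =
        dirDeriv a v ((dirDeriv a v ^ k) K) := by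
      intro k K; rw [pow_succ']; rfl
    rw [hs (n + 1), ih, map_add, dirDeriv_mul, mul_assoc, hc, dirDeriv_mul, hH, ← hs, ← hs]
    push_cast
    ring

/-- Induction on the monomial, one variable at a time. The vanishing of the next derivative is
carried along because it removes one of the two Leibniz terms when a coordinate of `a` is multiplied
in. -/
lemma exists_letterDegree_monomial (a : Fin r) (v : Fin 3 → ℂ) (d : Fin r × Fin 3 →₀ ℕ) (c : XU) :
    ∃ n : ℕ, HasLetterDegree a n (monomial d c) ∧
      (dirDeriv a v ^ n) (monomial d c) = (n.factorial : Symbolic r) *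
        letterSubst a v (monomial d c) ∧
      (dirDeriv a v ^ (n + 1)) (monomial d c) = 0 := by
  refine induction_on_monomial (motive := fun G => ∃ n : ℕ, HasLetterDegree a n G ∧
      (dirDeriv a v ^ n) G = (n.factorial : Symbolic r) * letterSubst a v G ∧
      (dirDeriv a v ^ (n + 1)) G = 0) ?_ ?_ d c
  · intro c
    refine ⟨0, isWeightedHomogeneous_C _ c, ?_, by simp [dirDeriv_C]⟩
    simp [letterSubst]
  · rintro G p ⟨n, hn, h1, h2⟩
    have hX : HasLetterDegree a (letterWeight a p) (X p : Symbolic r) :=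
      isWeightedHomogeneous_X _ _ _
    have hp : dirDeriv a v (dirDeriv a v (X p)) = 0 := by
      rw [dirDeriv_X]; split_ifs
      · rw [dirDeriv_C]
      · rw [map_zero]
    refine ⟨n + letterWeight a p, hn.mul hX, ?_⟩
    rw [mul_comm G, map_mul (letterSubst a v)]
    by_cases h : p.1 = a
    · have hw : letterWeight a p = 1 := if_pos h
      have hs : letterSubst a v (X p) = C (C (v p.2)) := by simp [letterSubst, h]
      rw [hw, dirDeriv_pow_succ_mul a v hp, dirDeriv_pow_succ_mul a v hp, h2, pow_succ',
        Module.End.mul_apply, h2, h1, dirDeriv_X, if_pos h, hs, Nat.factorial_succ]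
      simp only [map_zero, mul_zero, add_zero, zero_add, and_true]
      push_cast
      ring
    · have hw : letterWeight a p = 0 := if_neg h
      have hs : letterSubst a v (X p) = X p := by simp [letterSubst, h]
      have h0 : ∀ k, (dirDeriv a v ^ k) (X p * G) = X p * (dirDeriv a v ^ k) G := by
        intro k
        cases k with
        | zero => simp
        | succ k => rw [dirDeriv_pow_succ_mul a v hp, dirDeriv_X, if_neg h]; simp
      rw [hw, add_zero, h0, h0, h1, h2, hs]
      exact ⟨by ring, mul_zero _⟩

/-- Taylor's formula for a form of degree `n` in the letter, extended from monomials by linearity.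
-/
lemma dirDeriv_pow_of_letterDegree {a : Fin r} {n : ℕ} {G : Symbolic r}
    (hG : HasLetterDegree a n G) (v : Fin 3 → ℂ) :
    (dirDeriv a v ^ n) G = (n.factorial : Symbolic r) * letterSubst a v G := by
  induction hG using IsWeightedHomogeneous.induction_on with
  | zero => simp
  | add p q hp hq h1 h2 => rw [map_add, h1, h2, map_add, mul_add]
  | monomial d c hd =>
    -- The zero monomial is homogeneous of every degree, so uniqueness of the degree needs a nonzero
    -- coefficient.
    by_cases hc : c = 0
    · simp [hc]
    obtain ⟨k, hk, h1, -⟩ := exists_letterDegree_monomial a v d c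
    have : k = n := IsWeightedHomogeneous.inj_right (by simpa using hc) hk
      (isWeightedHomogeneous_monomial _ d c hd)
    rwa [this] at h1

/-- The fifth directional derivative produces `5!` times a substitution, and the normalization `1 /
5!` cancels this factor. -/
lemma letterIntegral_sum_linForm {ι : Type*} [Fintype ι] (c : ι → ℂ) (l : ι → Fin 3 → ℂ)
    {a : Fin r} {G : Symbolic r} (hG : HasLetterDegree a 5 G) :
    letterIntegral (∑ i, c i • linForm (l i) ^ 5) a G = ∑ i, c i • letterSubst a (l i) G := by
  rw [letterIntegral_eq, map_sum, LinearMap.sum_apply, Finset.smul_sum]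
  refine Finset.sum_congr rfl fun i _ => ?_
  rw [map_smul, letterOp_linForm_pow, LinearMap.smul_apply, dirDeriv_pow_of_letterDegree hG,
    smul_comm]
  congr 1
  have h : ((Nat.factorial 5 : ℕ) : Symbolic r) = algebraMap ℂ (Symbolic r) (Nat.factorial 5) := by
    simp
  rw [h, ← Algebra.smul_def, smul_smul, one_div_mul_cancel, one_smul]
  exact_mod_cast Nat.factorial_ne_zero 5

lemma HasLetterDegree.letterSubst {a b : Fin r} (hab : a ≠ b) {n : ℕ} {G : Symbolic r}
    (hG : HasLetterDegree a n G) (v : Fin 3 → ℂ) : HasLetterDegree a n (letterSubst b v G) := by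
  induction hG using IsWeightedHomogeneous.induction_on with
  | zero => simpa using isWeightedHomogeneous_zero _ _ _
  | add p q hp hq h1 h2 => rw [map_add]; exact h1.add h2
  | monomial d c hd =>
    rw [TernaryQuintic.letterSubst, aeval_monomial, ← hd, Finsupp.weight_apply, Finsupp.prod,
      Finsupp.sum]
    have := (isWeightedHomogeneous_C (letterWeight a) c).mul
      (IsWeightedHomogeneous.prod d.support
        (fun p => (if p.1 = b then C (C (v p.2)) else X p : Symbolic r) ^ d p)
        (fun p => d p • letterWeight a p) fun p _ => ?_)
    · rwa [zero_add] at this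
    · refine IsWeightedHomogeneous.pow (m := letterWeight a p) ?_ _
      split_ifs with h
      · rw [letterWeight, if_neg (by rw [h]; exact hab.symm)]
        exact isWeightedHomogeneous_C _ _
      · exact isWeightedHomogeneous_X _ _ _

lemma HasLetterDegree.sum_smul {ι : Type*} [Fintype ι] (c : ι → ℂ) {a : Fin r} {n : ℕ}
    {G : ι → Symbolic r} (hG : ∀ i, HasLetterDegree a n (G i)) :
    HasLetterDegree a n (∑ i, c i • G i) := by
  refine IsWeightedHomogeneous.sum _ _ _ fun i _ => ?_
  have h : c i • G i = C (C (c i)) * G i := by rw [Algebra.smul_def]; rfl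
  rw [h]
  exact (hG i).C_mul _

/-! ### Evaluation of a symbolic expression at numerical letters -/

/-- Evaluation of the letters at the vectors `v a` and of `x`, `u` at numerical vectors. -/
def symbolEval (v : Fin r → Fin 3 → ℂ) (x u : Fin 3 → ℂ) : Symbolic r →+* ℂ :=
  eval₂Hom (eval (Sum.elim x u)) fun p => v p.1 p.2

lemma symbolEval_smul (v : Fin r → Fin 3 → ℂ) (x u : Fin 3 → ℂ) (c : ℂ) (G : Symbolic r) :
    symbolEval v x u (c • G) = c * symbolEval v x u G := by
  have h : c • G = C (C c) * G := by rw [Algebra.smul_def]; rfl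
  rw [h, map_mul]
  simp [symbolEval]

lemma symbolEval_letterSubst (v : Fin r → Fin 3 → ℂ) (x u : Fin 3 → ℂ) (a : Fin r)
    (w : Fin 3 → ℂ) (G : Symbolic r) :
    symbolEval v x u (letterSubst a w G) = symbolEval (Function.update v a w) x u G := by
  have h : (symbolEval v x u).comp (letterSubst a w).toRingHom =
      symbolEval (Function.update v a w) x u := by
    refine MvPolynomial.ringHom_ext (fun c => ?_) fun p => ?_
    · simp [symbolEval, letterSubst]
    · obtain ⟨b, i⟩ := p
      by_cases h : b = a
      · subst h; simp [symbolEval, letterSubst]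
      · simp [symbolEval, letterSubst, h]
  exact congrArg (fun f => f G) h

/-- Taking the constant coefficient sets all letters to zero; this is why the iterated sums below
start from the assignment `0`, which is then overwritten letter by letter. -/
lemma eval_constantCoeff (x u : Fin 3 → ℂ) (G : Symbolic r) :
    eval (Sum.elim x u) (constantCoeff G) = symbolEval 0 x u G := by
  have h : (eval (Sum.elim x u)).comp constantCoeff = symbolEval (r := r) 0 x u := by
    refine MvPolynomial.ringHom_ext (fun c => ?_) fun p => ?_ <;> simp [symbolEval]
  exact congrArg (fun f => f G) h

/-- Iterated summation over the letters in a list: every letter in the list runs through the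
vectors `l i` with weights `c i`. -/
def letterSum {ι : Type*} [Fintype ι] (c : ι → ℂ) (l : ι → Fin 3 → ℂ)
    (φ : (Fin r → Fin 3 → ℂ) → ℂ) : List (Fin r) → (Fin r → Fin 3 → ℂ) → ℂ
  | [], v => φ v
  | a :: L, v => ∑ i, c i * letterSum c l φ L (Function.update v a (l i))

lemma HasLetterDegree.letterIntegral_sum {ι : Type*} [Fintype ι] (c : ι → ℂ)
    (l : ι → Fin 3 → ℂ) {a b : Fin r} (hab : a ≠ b) {G : Symbolic r}
    (ha : HasLetterDegree a 5 G) (hb : HasLetterDegree b 5 G) :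
    HasLetterDegree a 5 (letterIntegral (∑ i, c i • linForm (l i) ^ 5) b G) := by
  rw [letterIntegral_sum_linForm c l hb]
  exact HasLetterDegree.sum_smul c fun i => ha.letterSubst hab _

/-- Operators of other letters only substitute numbers for those letters, so a letter still to be
treated keeps degree five and the substitution formula remains applicable. -/
lemma HasLetterDegree.foldr_letterIntegral {ι : Type*} [Fintype ι] (c : ι → ℂ)
    (l : ι → Fin 3 → ℂ) {G : Symbolic r} (hG : ∀ a, HasLetterDegree a 5 G) {L : List (Fin r)}
    (hL : L.Nodup) {a : Fin r} (ha : a ∉ L) :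
    HasLetterDegree a 5 (L.foldr (letterIntegral (∑ i, c i • linForm (l i) ^ 5)) G) := by
  induction L generalizing a with
  | nil => exact hG a
  | cons b L ih =>
    rw [List.nodup_cons] at hL
    rw [List.mem_cons, not_or] at ha
    exact (ih hL.2 ha.2).letterIntegral_sum c l ha.1 (ih hL.2 hL.1)

lemma symbolEval_foldr_letterIntegral {ι : Type*} [Fintype ι] (c : ι → ℂ)
    (l : ι → Fin 3 → ℂ) {G : Symbolic r} (hG : ∀ a, HasLetterDegree a 5 G) (x u : Fin 3 → ℂ)
    {L : List (Fin r)} (hL : L.Nodup) (v : Fin r → Fin 3 → ℂ) :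
    symbolEval v x u (L.foldr (letterIntegral (∑ i, c i • linForm (l i) ^ 5)) G) =
      letterSum c l (fun w => symbolEval w x u G) L v := by
  induction L generalizing v with
  | nil => rfl
  | cons b L ih =>
    rw [List.nodup_cons] at hL
    rw [List.foldr_cons, letterIntegral_sum_linForm c l
      (HasLetterDegree.foldr_letterIntegral c l hG hL.2 hL.1), map_sum, letterSum]
    refine Finset.sum_congr rfl fun i _ => ?_
    rw [symbolEval_smul, symbolEval_letterSubst, ih hL.2]

theorem eval_symbolicValue {ι : Type*} [Fintype ι] (c : ι → ℂ) (l : ι → Fin 3 → ℂ)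
    {G : Symbolic r} (hG : ∀ a, HasLetterDegree a 5 G) (x u : Fin 3 → ℂ) :
    eval (Sum.elim x u) (symbolicValue (∑ i, c i • linForm (l i) ^ 5) G) =
      letterSum c l (fun w => symbolEval w x u G) (List.finRange r) 0 := by
  rw [symbolicValue, eval_constantCoeff,
    symbolEval_foldr_letterIntegral c l hG x u (List.nodup_finRange r)]

/-! ### Evaluation of a tableau -/

lemma hasLetterDegree_letter (a b : Fin r) (i : Fin 3) :
    HasLetterDegree a (List.count a [b]) (letter b i) := by
  have : List.count a [b] = letterWeight a (b, i) := by
    simp [List.count_singleton, letterWeight]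
  rw [this]
  exact isWeightedHomogeneous_X _ _ _

lemma hasLetterDegree_bracket {a : Fin r} {k m n : ℕ} {v w z : Fin 3 → Symbolic r}
    (hv : ∀ i, HasLetterDegree a k (v i)) (hw : ∀ i, HasLetterDegree a m (w i))
    (hz : ∀ i, HasLetterDegree a n (z i)) : HasLetterDegree a (k + m + n) (bracket v w z) := by
  have h : ∀ i j t, HasLetterDegree a (k + m + n) (v i * w j * z t) := fun i j t =>
    ((hv i).mul (hw j)).mul (hz t)
  rw [bracket, Matrix.det_fin_three]
  simp only [Matrix.of_apply, Matrix.cons_val]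
  exact (((((h 0 1 2).sub (h 0 2 1)).sub (h 1 0 2)).add (h 1 2 0)).add (h 2 0 1)).sub (h 2 1 0)

lemma hasLetterDegree_columnFactor (a : Fin r) {s : List (Fin r)} (hs : 1 ≤ s.length)
    (hs' : s.length ≤ 3) : HasLetterDegree a (s.count a) (columnFactor s) := by
  match s, hs, hs' with
  | [b], _, _ =>
    refine IsWeightedHomogeneous.sum _ _ _ fun i _ => ?_
    exact (hasLetterDegree_letter a b i).mul (isWeightedHomogeneous_C _ _)
  | [b, d], _, _ =>
    have h : List.count a [b, d] = List.count a [b] + List.count a [d] + 0 := by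
      rw [← List.count_append]; rfl
    rw [h]
    exact hasLetterDegree_bracket (hasLetterDegree_letter a b) (hasLetterDegree_letter a d)
      fun i => isWeightedHomogeneous_C _ _
  | [b, d, e], _, _ =>
    have h : List.count a [b, d, e] = List.count a [b] + List.count a [d] + List.count a [e] := by
      rw [← List.count_append, ← List.count_append]; rfl
    rw [h]
    exact hasLetterDegree_bracket (hasLetterDegree_letter a b) (hasLetterDegree_letter a d)
      (hasLetterDegree_letter a e)

variable {m : ℕ}

/-- The columns of `T` have between one and three entries, and every letter occurs five times. -/
def IsQuinticTableau (T : Matrix (Fin m) (Fin r) ℕ) : Prop :=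
  (∀ j ∈ Finset.range (tableauWidth T),
    1 ≤ (tableauColumn T j).length ∧ (tableauColumn T j).length ≤ 3) ∧
  ∀ a, ∑ j ∈ Finset.range (tableauWidth T), (tableauColumn T j).count a = 5

instance (T : Matrix (Fin m) (Fin r) ℕ) : Decidable (IsQuinticTableau T) := by
  unfold IsQuinticTableau; infer_instance

lemma IsQuinticTableau.hasLetterDegree {T : Matrix (Fin m) (Fin r) ℕ} (hT : IsQuinticTableau T)
    (a : Fin r) : HasLetterDegree a 5 (tableauSymbol T) := by
  rw [← hT.2 a]
  exact IsWeightedHomogeneous.prod _ _ _ fun j hj =>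
    hasLetterDegree_columnFactor a (hT.1 j hj).1 (hT.1 j hj).2

/-- The determinant with rows `v`, `w`, `z`. -/
def det3 (v w z : Fin 3 → ℂ) : ℂ := (Matrix.of ![v, w, z]).det

/-- The value of a column factor at numerical letters. -/
def columnEval (v : Fin r → Fin 3 → ℂ) (x u : Fin 3 → ℂ) : List (Fin r) → ℂ
  | [a] => v a ⬝ᵥ x
  | [a, b] => det3 (v a) (v b) u
  | [a, b, c] => det3 (v a) (v b) (v c)
  | _ => 1

lemma symbolEval_bracket (v : Fin r → Fin 3 → ℂ) (x u : Fin 3 → ℂ)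
    (p q s : Fin 3 → Symbolic r) :
    symbolEval v x u (bracket p q s) = det3 (fun i => symbolEval v x u (p i))
      (fun i => symbolEval v x u (q i)) fun i => symbolEval v x u (s i) := by
  simp [bracket, det3, Matrix.det_fin_three]

lemma symbolEval_columnFactor (v : Fin r → Fin 3 → ℂ) (x u : Fin 3 → ℂ) (s : List (Fin r)) :
    symbolEval v x u (columnFactor s) = columnEval v x u s := by
  have hl : ∀ a i, symbolEval v x u (letter a i) = v a i := fun a i => by
    simp [symbolEval, letter]
  have hx : ∀ i, symbolEval v x u (xVec i) = x i := fun i => by simp [symbolEval, xVec]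
  have hu : ∀ i, symbolEval v x u (uVec i) = u i := fun i => by simp [symbolEval, uVec]
  match s with
  | [] => simp [columnFactor, columnEval]
  | [a] => simp [columnFactor, columnEval, hl, hx, dotProduct]
  | [a, b] => simp [columnFactor, columnEval, symbolEval_bracket, hl, hu]
  | [a, b, c] => simp [columnFactor, columnEval, symbolEval_bracket, hl]
  | _ :: _ :: _ :: _ :: _ => simp [columnFactor, columnEval]

theorem eval_concomitant {ι : Type*} [Fintype ι] (c : ι → ℂ) (l : ι → Fin 3 → ℂ)
    {T : Matrix (Fin m) (Fin r) ℕ} (hT : IsQuinticTableau T) (x u : Fin 3 → ℂ) :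
    eval (Sum.elim x u) (concomitant T (∑ i, c i • linForm (l i) ^ 5)) =
      letterSum c l
        (fun v => ∏ j ∈ Finset.range (tableauWidth T), columnEval v x u (tableauColumn T j))
        (List.finRange r) 0 := by
  rw [concomitant, eval_symbolicValue c l hT.hasLetterDegree]
  simp only [tableauSymbol, map_prod, symbolEval_columnFactor]

/-! ### Explicit values of the concomitants on a sum of fifth powers -/

section Values

variable {ι : Type*} [Fintype ι] (c : ι → ℂ) (l : ι → Fin 3 → ℂ)

lemma letterSum_two (φ : (Fin 2 → Fin 3 → ℂ) → ℂ) :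
    letterSum c l φ (List.finRange 2) 0 = ∑ i, c i * ∑ j, c j * φ ![l i, l j] := by
  have h : ∀ w₁ w₂ : Fin 3 → ℂ,
      Function.update (Function.update (0 : Fin 2 → Fin 3 → ℂ) 0 w₁) 1 w₂ = ![w₁, w₂] := by
    intro w₁ w₂
    funext a
    fin_cases a <;> simp
  simp only [List.finRange_succ, List.finRange_zero, List.map_nil, List.map_cons, letterSum,
    Fin.succ_zero_eq_one, h]

lemma letterSum_three (φ : (Fin 3 → Fin 3 → ℂ) → ℂ) :
    letterSum c l φ (List.finRange 3) 0 =
      ∑ i, c i * ∑ j, c j * ∑ k, c k * φ ![l i, l j, l k] := by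
  have h : ∀ w₁ w₂ w₃ : Fin 3 → ℂ, Function.update (Function.update (Function.update
      (0 : Fin 3 → Fin 3 → ℂ) 0 w₁) 1 w₂) 2 w₃ = ![w₁, w₂, w₃] := by
    intro w₁ w₂ w₃
    funext a
    fin_cases a <;> simp
  simp only [List.finRange_succ, List.finRange_zero, List.map_nil, List.map_cons, letterSum,
    Fin.succ_zero_eq_one, Fin.succ_one_eq_two, h]

lemma letterSum_four (φ : (Fin 4 → Fin 3 → ℂ) → ℂ) :
    letterSum c l φ (List.finRange 4) 0 =
      ∑ i, c i * ∑ j, c j * ∑ k, c k * ∑ m, c m * φ ![l i, l j, l k, l m] := by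
  have h : ∀ w₁ w₂ w₃ w₄ : Fin 3 → ℂ, Function.update (Function.update (Function.update
      (Function.update (0 : Fin 4 → Fin 3 → ℂ) 0 w₁) 1 w₂) 2 w₃) 3 w₄ = ![w₁, w₂, w₃, w₄] := by
    intro w₁ w₂ w₃ w₄
    funext a
    fin_cases a <;> simp
  have h3 : (Fin.succ 2 : Fin 4) = 3 := rfl
  simp only [List.finRange_succ, List.finRange_zero, List.map_nil, List.map_cons, letterSum,
    Fin.succ_zero_eq_one, Fin.succ_one_eq_two, h3, h]

/-- The list of the columns of a tableau. -/
def tableauColumns {m r : ℕ} (T : Matrix (Fin m) (Fin r) ℕ) : List (List (Fin r)) :=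
  (List.range (tableauWidth T)).map (tableauColumn T)

lemma eval_concomitant_columns {m r : ℕ} {T : Matrix (Fin m) (Fin r) ℕ}
    (hT : IsQuinticTableau T) {s : List (List (Fin r))} (hs : tableauColumns T = s)
    (x u : Fin 3 → ℂ) :
    eval (Sum.elim x u) (concomitant T (∑ i, c i • linForm (l i) ^ 5)) =
      letterSum c l (fun v => (s.map (columnEval v x u)).prod) (List.finRange r) 0 := by
  rw [eval_concomitant c l hT, ← hs]
  congr 1
  funext v
  rw [tableauColumns, List.map_map]
  rfl

/-- Factors a nested sum along the graph whose edges are the brackets: whatever does not involve the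
innermost letter is pulled out. -/
lemma sum_mul_eq_mul_sum_of_eq (c : ι → ℂ) {f : ι → ℂ} (a : ℂ) (g : ι → ℂ)
    (h : ∀ i, f i = a * g i) : ∑ i, c i * f i = a * ∑ i, c i * g i := by
  rw [Finset.mul_sum]
  exact Finset.sum_congr rfl fun i _ => by rw [h]; ring

variable {c l}

/-- The values `D` and `p` are left abstract in this and the following formulas, to suit both the
pencil and the choice `u = x × y`. Here the brackets form a star centred at the first letter, so the
sums over the other three letters separate. -/
lemma eval_concomitant_5344_0211 {x u : Fin 3 → ℂ} {D : ι → ι → ℂ} {p : ι → ℂ}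
    (hD : ∀ i j, det3 (l i) (l j) u = D i j) (hp : ∀ i, l i ⬝ᵥ x = p i) :
    eval (Sum.elim x u) (concomitant !![5, 3, 4, 4; 0, 2, 1, 1] (∑ i, c i • linForm (l i) ^ 5)) =
      ∑ i, c i * (p i * (∑ k, c k * (D i k * p k ^ 4)) ^ 2 * ∑ j, c j * (D i j ^ 2 * p j ^ 3)) :=
        by
  rw [eval_concomitant_columns c l (by decide) (s := [[0, 1], [0, 1], [0, 2], [0, 3], [0], [1],
    [1], [1], [2], [2], [2], [2], [3], [3], [3], [3]]) (by decide), letterSum_four]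
  simp only [List.map_cons, List.map_nil, List.prod_cons, List.prod_nil, columnEval,
    Matrix.cons_val, hD, hp]
  refine Finset.sum_congr rfl fun i _ => congrArg _ ?_
  refine (sum_mul_eq_mul_sum_of_eq c (p i * (∑ k, c k * (D i k * p k ^ 4)) ^ 2) (fun j => D i j ^
    2 * p j ^ 3) fun j => ?_).trans (by ring)
  refine (sum_mul_eq_mul_sum_of_eq c (p i * (∑ k, c k * (D i k * p k ^ 4)) * (D i j ^ 2 * p j ^
    3)) (fun k => D i k * p k ^ 4) fun k => ?_).trans (by ring)
  refine (sum_mul_eq_mul_sum_of_eq c (p i * (D i k * p k ^ 4) * (D i j ^ 2 * p j ^ 3)) (fun m =>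
    D i m * p m ^ 4) fun m => by ring).trans (by ring)

lemma eval_concomitant_5155_0400 {x u : Fin 3 → ℂ} {D : ι → ι → ℂ} {p : ι → ℂ}
    (hD : ∀ i j, det3 (l i) (l j) u = D i j) (hp : ∀ i, l i ⬝ᵥ x = p i) :
    eval (Sum.elim x u) (concomitant !![5, 1, 5, 5; 0, 4, 0, 0] (∑ i, c i • linForm (l i) ^ 5)) =
      ∑ i, c i * (p i * (∑ k, c k * p k ^ 5) ^ 2 * ∑ j, c j * (D i j ^ 4 * p j)) := by
  rw [eval_concomitant_columns c l (by decide) (s := [[0, 1], [0, 1], [0, 1], [0, 1], [0], [1],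
    [2], [2], [2], [2], [2], [3], [3], [3], [3], [3]]) (by decide), letterSum_four]
  simp only [List.map_cons, List.map_nil, List.prod_cons, List.prod_nil, columnEval,
    Matrix.cons_val, hD, hp]
  refine Finset.sum_congr rfl fun i _ => congrArg _ ?_
  refine (sum_mul_eq_mul_sum_of_eq c (p i * (∑ k, c k * p k ^ 5) ^ 2) (fun j => D i j ^ 4 * p j)
    fun j => ?_).trans (by ring)
  refine (sum_mul_eq_mul_sum_of_eq c (p i * (∑ k, c k * p k ^ 5) * (D i j ^ 4 * p j)) (fun k => p
    k ^ 5) fun k => ?_).trans (by ring)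
  refine (sum_mul_eq_mul_sum_of_eq c (p i * p k ^ 5 * (D i j ^ 4 * p j)) (fun m => p m ^ 5) fun m
    => by ring).trans (by ring)

lemma eval_concomitant_5540_0015 {x u : Fin 3 → ℂ} {D : ι → ι → ℂ} {p : ι → ℂ}
    (hD : ∀ i j, det3 (l i) (l j) u = D i j) (hp : ∀ i, l i ⬝ᵥ x = p i) :
    eval (Sum.elim x u) (concomitant !![5, 5, 4, 0; 0, 0, 1, 5] (∑ i, c i • linForm (l i) ^ 5)) =
      ∑ i, c i * ((∑ k, c k * (D i k * p k ^ 4)) * ∑ j, c j * (p j ^ 4 * ∑ k, c k * (D i k ^ 4 *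
        D j k))) := by
  rw [eval_concomitant_columns c l (by decide) (s := [[0, 2], [0, 3], [0, 3], [0, 3], [0, 3], [1,
    3], [1], [1], [1], [1], [2], [2], [2], [2]]) (by decide), letterSum_four]
  simp only [List.map_cons, List.map_nil, List.prod_cons, List.prod_nil, columnEval,
    Matrix.cons_val, hD, hp]
  refine Finset.sum_congr rfl fun i _ => congrArg _ ?_
  refine (sum_mul_eq_mul_sum_of_eq c (∑ k, c k * (D i k * p k ^ 4)) (fun j => p j ^ 4 * ∑ k, c k
    * (D i k ^ 4 * D j k)) fun j => ?_).trans (by ring)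
  refine (sum_mul_eq_mul_sum_of_eq c (p j ^ 4 * ∑ k, c k * (D i k ^ 4 * D j k)) (fun k => D i k *
    p k ^ 4) fun k => ?_).trans (by ring)
  refine (sum_mul_eq_mul_sum_of_eq c (p j ^ 4 * (D i k * p k ^ 4)) (fun m => D i m ^ 4 * D j m)
    fun m => by ring).trans (by ring)

lemma eval_concomitant_5405_0150 {x u : Fin 3 → ℂ} {D : ι → ι → ℂ} {p : ι → ℂ}
    (hD : ∀ i j, det3 (l i) (l j) u = D i j) (hp : ∀ i, l i ⬝ᵥ x = p i) :
    eval (Sum.elim x u) (concomitant !![5, 4, 0, 5; 0, 1, 5, 0] (∑ i, c i • linForm (l i) ^ 5)) =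
      ∑ i, c i * ((∑ k, c k * p k ^ 5) * ∑ j, c j * (D i j * p j ^ 3 * ∑ k, c k * (D i k ^ 4 * D
        j k))) := by
  rw [eval_concomitant_columns c l (by decide) (s := [[0, 1], [0, 2], [0, 2], [0, 2], [0, 2], [1,
    2], [1], [1], [1], [3], [3], [3], [3], [3]]) (by decide), letterSum_four]
  simp only [List.map_cons, List.map_nil, List.prod_cons, List.prod_nil, columnEval,
    Matrix.cons_val, hD, hp]
  refine Finset.sum_congr rfl fun i _ => congrArg _ ?_
  refine (sum_mul_eq_mul_sum_of_eq c (∑ k, c k * p k ^ 5) (fun j => D i j * p j ^ 3 * ∑ k, c k *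
    (D i k ^ 4 * D j k)) fun j => ?_).trans (by ring)
  refine (sum_mul_eq_mul_sum_of_eq c ((∑ k, c k * p k ^ 5) * (D i j * p j ^ 3)) (fun k => D i k ^
    4 * D j k) fun k => ?_).trans (by ring)
  refine (sum_mul_eq_mul_sum_of_eq c (D i j * p j ^ 3 * (D i k ^ 4 * D j k)) (fun m => p m ^ 5)
    fun m => by ring).trans (by ring)

lemma eval_concomitant_51_04 {x u : Fin 3 → ℂ} {D : ι → ι → ℂ} {p : ι → ℂ}
    (hD : ∀ i j, det3 (l i) (l j) u = D i j) (hp : ∀ i, l i ⬝ᵥ x = p i) :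
    eval (Sum.elim x u) (concomitant !![5, 1; 0, 4] (∑ i, c i • linForm (l i) ^ 5)) =
      ∑ i, c i * (p i * ∑ j, c j * (D i j ^ 4 * p j)) := by
  rw [eval_concomitant_columns c l (by decide) (s := [[0, 1], [0, 1], [0, 1], [0, 1], [0], [1]])
    (by decide), letterSum_two]
  simp only [List.map_cons, List.map_nil, List.prod_cons, List.prod_nil, columnEval,
    Matrix.cons_val, hD, hp]
  refine Finset.sum_congr rfl fun i _ => congrArg _ ?_
  refine (sum_mul_eq_mul_sum_of_eq c (p i) (fun j => D i j ^ 4 * p j) fun j => by ring).trans (by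
    ring)

lemma eval_concomitant_5322_0233 {x u : Fin 3 → ℂ} {D : ι → ι → ℂ} {p : ι → ℂ}
    (hD : ∀ i j, det3 (l i) (l j) u = D i j) (hp : ∀ i, l i ⬝ᵥ x = p i) :
    eval (Sum.elim x u) (concomitant !![5, 3, 2, 2; 0, 2, 3, 3] (∑ i, c i • linForm (l i) ^ 5)) =
      ∑ i, c i * ((∑ k, c k * (D i k ^ 3 * p k ^ 2)) * ∑ j, c j * (D i j ^ 2 * ∑ k, c k * (D j k
        ^ 3 * p k ^ 2))) := by
  rw [eval_concomitant_columns c l (by decide) (s := [[0, 1], [0, 1], [0, 2], [0, 2], [0, 2], [1,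
    3], [1, 3], [1, 3], [2], [2], [3], [3]]) (by decide), letterSum_four]
  simp only [List.map_cons, List.map_nil, List.prod_cons, List.prod_nil, columnEval,
    Matrix.cons_val, hD, hp]
  refine Finset.sum_congr rfl fun i _ => congrArg _ ?_
  refine (sum_mul_eq_mul_sum_of_eq c (∑ k, c k * (D i k ^ 3 * p k ^ 2)) (fun j => D i j ^ 2 * ∑
    k, c k * (D j k ^ 3 * p k ^ 2)) fun j => ?_).trans (by ring)
  refine (sum_mul_eq_mul_sum_of_eq c (D i j ^ 2 * ∑ k, c k * (D j k ^ 3 * p k ^ 2)) (fun k => D i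
    k ^ 3 * p k ^ 2) fun k => ?_).trans (by ring)
  refine (sum_mul_eq_mul_sum_of_eq c (D i j ^ 2 * (D i k ^ 3 * p k ^ 2)) (fun m => D j m ^ 3 * p
    m ^ 2) fun m => by ring).trans (by ring)

/-- Every column has two entries, so `x` does not enter. The brackets form a 4-cycle, and only the
sum over the last letter is isolated. -/
lemma eval_concomitant_5320_0235 {x u : Fin 3 → ℂ} {D : ι → ι → ℂ}
    (hD : ∀ i j, det3 (l i) (l j) u = D i j) :
    eval (Sum.elim x u) (concomitant !![5, 3, 2, 0; 0, 2, 3, 5] (∑ i, c i • linForm (l i) ^ 5)) =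
      ∑ i, c i * ∑ j, c j * (D i j ^ 2 * ∑ k, c k * (D i k ^ 3 * ∑ m, c m * (D j m ^ 3 * D k m ^
        2))) := by
  rw [eval_concomitant_columns c l (by decide) (s := [[0, 1], [0, 1], [0, 2], [0, 2], [0, 2], [1,
    3], [1, 3], [1, 3], [2, 3], [2, 3]]) (by decide), letterSum_four]
  simp only [List.map_cons, List.map_nil, List.prod_cons, List.prod_nil, columnEval,
    Matrix.cons_val, hD]
  refine Finset.sum_congr rfl fun i _ => congrArg _ ?_
  refine (sum_mul_eq_mul_sum_of_eq c (1) (fun j => D i j ^ 2 * ∑ k, c k * (D i k ^ 3 * ∑ m, c m *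
    (D j m ^ 3 * D k m ^ 2))) fun j => ?_).trans (by ring)
  refine (sum_mul_eq_mul_sum_of_eq c (D i j ^ 2) (fun k => D i k ^ 3 * ∑ m, c m * (D j m ^ 3 * D
    k m ^ 2)) fun k => ?_).trans (by ring)
  refine (sum_mul_eq_mul_sum_of_eq c (D i j ^ 2 * D i k ^ 3) (fun m => D j m ^ 3 * D k m ^ 2) fun
    m => by ring).trans (by ring)

end Values

/-! ### A triple line plus a double line annihilates the concomitants -/

lemma eval_linForm (v x : Fin 3 → ℂ) : eval x (linForm v) = v ⬝ᵥ x := by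
  simp [linForm, dotProduct]

lemma XU_eq_zero {P : XU} (h : ∀ x u : Fin 3 → ℂ, eval (Sum.elim x u) P = 0) : P = 0 := by
  refine MvPolynomial.funext fun y => ?_
  rw [map_zero, ← Sum.elim_comp_inl_inr y]
  exact h _ _

/-- Nodes of a cubature formula. -/
def node : Fin 5 → ℂ := ![0, 1, -1, 2, -2]

/-- Weights for which `∑ i, nodeWeight i * node i ^ k` is `1 / 10` for `k = 2`, and zero for the
other `k ≤ 5`. -/
def nodeWeight : Fin 5 → ℂ := ![-1 / 8, 1 / 15, 1 / 15, -1 / 240, -1 / 240]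

lemma sum_nodeWeight (φ : Fin 5 → ℂ) : ∑ i, nodeWeight i * φ i =
    -1 / 8 * φ 0 + 1 / 15 * φ 1 + 1 / 15 * φ 2 - 1 / 240 * φ 3 - 1 / 240 * φ 4 := by
  simp only [Fin.sum_univ_five, nodeWeight, Matrix.cons_val]
  ring

lemma node_zero : node 0 = 0 := rfl
lemma node_one : node 1 = 1 := rfl
lemma node_two : node 2 = -1 := rfl
lemma node_three : node 3 = 2 := rfl
lemma node_four : node 4 = -2 := rfl

section

variable (v w : Fin 3 → ℂ)

/-- The coefficient of `t²` in `(v + t w)⁵` is `10 v³ w²`, and the weights extract one tenth of that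
coefficient. -/
lemma linForm_pow_mul_pow :
    linForm v ^ 3 * linForm w ^ 2 = ∑ i, nodeWeight i • linForm (v + node i • w) ^ 5 := by
  refine MvPolynomial.funext fun x => ?_
  simp only [map_mul, map_pow, map_sum, smul_eval, eval_linForm, add_dotProduct, smul_dotProduct,
    sum_nodeWeight, node_zero, node_one, node_two, node_three, node_four, smul_eq_mul]
  ring

lemma det3_pencil (u : Fin 3 → ℂ) (s t : ℂ) :
    det3 (v + s • w) (v + t • w) u = (t - s) * det3 v w u := by
  simp only [det3, Matrix.det_fin_three, Matrix.of_apply, Matrix.cons_val, Pi.add_apply,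
    Pi.smul_apply, smul_eq_mul]
  ring

lemma det3_pencil_pencil (s t q : ℂ) : det3 (v + s • w) (v + t • w) (v + q • w) = 0 := by
  simp only [det3, Matrix.det_fin_three, Matrix.of_apply, Matrix.cons_val, Pi.add_apply,
    Pi.smul_apply, smul_eq_mul]
  ring

/-- A column with three letters contributes a determinant of three vectors in the span of `v` and
`w`. -/
lemma concomitant_three_eq_zero {T : Matrix (Fin 3) (Fin 3) ℕ} (hT : IsQuinticTableau T)
    (h : [0, 1, 2] ∈ tableauColumns T) : concomitant T (linForm v ^ 3 * linForm w ^ 2) = 0 := by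
  refine XU_eq_zero fun x u => ?_
  rw [linForm_pow_mul_pow, eval_concomitant_columns _ _ hT rfl, letterSum_three]
  have h0 : ∀ i j k, ((tableauColumns T).map (columnEval
      ![v + node i • w, v + node j • w, v + node k • w] x u)).prod = 0 := fun i j k =>
    List.prod_eq_zero (List.mem_map.2 ⟨_, h, det3_pencil_pencil v w _ _ _⟩)
  simp only [h0, mul_zero, Finset.sum_const_zero]

theorem cov3_linForm : ∀ Ψ ∈ cov3, Ψ (linForm v ^ 3 * linForm w ^ 2) = 0 := by
  simp only [cov3, List.forall_mem_cons, List.not_mem_nil, false_imp_iff, implies_true, and_true]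
  refine ⟨?_, ?_, ?_, ?_, ?_, ?_, ?_⟩ <;>
    exact concomitant_three_eq_zero v w (by decide) (by decide)

lemma cov4_first_linForm :
    50 * concomitant !![5, 3, 4, 4; 0, 2, 1, 1] (linForm v ^ 3 * linForm w ^ 2)
      - 19 * concomitant !![5, 1, 5, 5; 0, 4, 0, 0] (linForm v ^ 3 * linForm w ^ 2) = 0 := by
  refine XU_eq_zero fun x u => ?_
  have hp : ∀ i, (v + node i • w) ⬝ᵥ x = v ⬝ᵥ x + node i * w ⬝ᵥ x := fun i => by
    rw [add_dotProduct, smul_dotProduct, smul_eq_mul]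
  rw [linForm_pow_mul_pow, map_sub, map_mul, map_mul,
    eval_concomitant_5344_0211 (fun i j => det3_pencil v w u _ _) hp,
    eval_concomitant_5155_0400 (fun i j => det3_pencil v w u _ _) hp]
  generalize v ⬝ᵥ x = P, w ⬝ᵥ x = Q, det3 v w u = κ
  -- Each summand has degree five in `node k`, so the weighted sum is one tenth of the coefficient
  -- of its square. The same rule gives the other inner sums here and in the next three lemmas.
  have hA : ∀ i, ∑ k, nodeWeight k * ((node k - node i) * κ * (P + node k * Q) ^ 4) =
      κ * P ^ 2 * Q * (2 * P - 3 * node i * Q) / 5 := fun i => by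
    rw [sum_nodeWeight, node_zero, node_one, node_two, node_three, node_four]; ring
  have hB : ∀ i, ∑ k, nodeWeight k * (((node k - node i) * κ) ^ 2 * (P + node k * Q) ^ 3) =
      κ ^ 2 * (3 * P * Q ^ 2 * node i ^ 2 - 6 * P ^ 2 * Q * node i + P ^ 3) / 10 := fun i => by
    rw [sum_nodeWeight, node_zero, node_one, node_two, node_three, node_four]; ring
  have hC : ∀ i, ∑ k, nodeWeight k * (((node k - node i) * κ) ^ 4 * (P + node k * Q)) =
      κ ^ 4 * (6 * P * node i ^ 2 - 4 * Q * node i ^ 3) / 10 := fun i => by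
    rw [sum_nodeWeight, node_zero, node_one, node_two, node_three, node_four]; ring
  have hN : ∑ k, nodeWeight k * (P + node k * Q) ^ 5 = P ^ 3 * Q ^ 2 := by
    rw [sum_nodeWeight, node_zero, node_one, node_two, node_three, node_four]; ring
  simp only [hA, hB, hC, hN, sum_nodeWeight, node_zero, node_one, node_two, node_three, node_four,
    map_ofNat]
  ring

lemma cov4_second_linForm :
    5 * concomitant !![5, 5, 4, 0; 0, 0, 1, 5] (linForm v ^ 3 * linForm w ^ 2)
      - 8 * concomitant !![5, 4, 0, 5; 0, 1, 5, 0] (linForm v ^ 3 * linForm w ^ 2) = 0 := by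
  refine XU_eq_zero fun x u => ?_
  have hp : ∀ i, (v + node i • w) ⬝ᵥ x = v ⬝ᵥ x + node i * w ⬝ᵥ x := fun i => by
    rw [add_dotProduct, smul_dotProduct, smul_eq_mul]
  rw [linForm_pow_mul_pow, map_sub, map_mul, map_mul,
    eval_concomitant_5540_0015 (fun i j => det3_pencil v w u _ _) hp,
    eval_concomitant_5405_0150 (fun i j => det3_pencil v w u _ _) hp]
  generalize v ⬝ᵥ x = P, w ⬝ᵥ x = Q, det3 v w u = κ
  have hA : ∀ i, ∑ k, nodeWeight k * ((node k - node i) * κ * (P + node k * Q) ^ 4) =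
      κ * P ^ 2 * Q * (2 * P - 3 * node i * Q) / 5 := fun i => by
    rw [sum_nodeWeight, node_zero, node_one, node_two, node_three, node_four]; ring
  have hW : ∀ i j, ∑ k, nodeWeight k * (((node k - node i) * κ) ^ 4 * ((node k - node j) * κ)) =
      κ ^ 5 * (-4 * node i ^ 3 - 6 * node i ^ 2 * node j) / 10 := fun i j => by
    rw [sum_nodeWeight, node_zero, node_one, node_two, node_three, node_four]; ring
  have hN : ∑ k, nodeWeight k * (P + node k * Q) ^ 5 = P ^ 3 * Q ^ 2 := by
    rw [sum_nodeWeight, node_zero, node_one, node_two, node_three, node_four]; ring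
  simp only [hA, hW, hN, sum_nodeWeight, node_zero, node_one, node_two, node_three, node_four,
    map_ofNat]
  ring

lemma cov4_third_linForm :
    concomitant !![5, 1; 0, 4] (linForm v ^ 3 * linForm w ^ 2) ^ 2
      + 2 * concomitant !![5, 3, 2, 2; 0, 2, 3, 3] (linForm v ^ 3 * linForm w ^ 2) = 0 := by
  refine XU_eq_zero fun x u => ?_
  have hp : ∀ i, (v + node i • w) ⬝ᵥ x = v ⬝ᵥ x + node i * w ⬝ᵥ x := fun i => by
    rw [add_dotProduct, smul_dotProduct, smul_eq_mul]
  rw [linForm_pow_mul_pow, map_add, map_mul, map_pow,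
    eval_concomitant_51_04 (fun i j => det3_pencil v w u _ _) hp,
    eval_concomitant_5322_0233 (fun i j => det3_pencil v w u _ _) hp]
  generalize v ⬝ᵥ x = P, w ⬝ᵥ x = Q, det3 v w u = κ
  have hC : ∀ i, ∑ k, nodeWeight k * (((node k - node i) * κ) ^ 4 * (P + node k * Q)) =
      κ ^ 4 * (6 * P * node i ^ 2 - 4 * Q * node i ^ 3) / 10 := fun i => by
    rw [sum_nodeWeight, node_zero, node_one, node_two, node_three, node_four]; ring
  have hH : ∀ i, ∑ k, nodeWeight k * (((node k - node i) * κ) ^ 3 * (P + node k * Q) ^ 2) =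
      κ ^ 3 * (-3 * P ^ 2 * node i + 6 * P * Q * node i ^ 2 - Q ^ 2 * node i ^ 3) / 10 := fun i => by
    rw [sum_nodeWeight, node_zero, node_one, node_two, node_three, node_four]; ring
  simp only [hC, hH, sum_nodeWeight, node_zero, node_one, node_two, node_three, node_four,
    map_ofNat]
  ring

lemma cov4_fourth_linForm :
    concomitant !![5, 3, 2, 0; 0, 2, 3, 5] (linForm v ^ 3 * linForm w ^ 2) = 0 := by
  refine XU_eq_zero fun x u => ?_
  rw [linForm_pow_mul_pow, eval_concomitant_5320_0235 (fun i j => det3_pencil v w u _ _)]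
  generalize det3 v w u = κ
  have hK : ∀ j k, ∑ m, nodeWeight m *
      (((node m - node j) * κ) ^ 3 * ((node m - node k) * κ) ^ 2) =
      κ ^ 5 * (-node j ^ 3 - 6 * node j ^ 2 * node k - 3 * node j * node k ^ 2) / 10 :=
    fun i j => by
      rw [sum_nodeWeight, node_zero, node_one, node_two, node_three, node_four]; ring
  simp only [hK, sum_nodeWeight, node_zero, node_one, node_two, node_three, node_four]
  ring

theorem cov4_linForm : ∀ Ψ ∈ cov4, Ψ (linForm v ^ 3 * linForm w ^ 2) = 0 := by
  simp only [cov4, List.forall_mem_cons, List.not_mem_nil, false_imp_iff, implies_true, and_true]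
  exact ⟨cov4_first_linForm v w, cov4_second_linForm v w, cov4_third_linForm v w,
    cov4_fourth_linForm v w⟩

end

/-! ### Quintics as sums of fifth powers -/

lemma linForm_add (v w : Fin 3 → ℂ) : linForm (v + w) = linForm v + linForm w :=
  MvPolynomial.funext fun x => by simp [eval_linForm, add_dotProduct]

lemma linForm_smul (s : ℂ) (v : Fin 3 → ℂ) : linForm (s • v) = C s * linForm v :=
  MvPolynomial.funext fun x => by simp [eval_linForm, smul_dotProduct]

lemma isHomogeneous_linForm (v : Fin 3 → ℂ) : (linForm v).IsHomogeneous 1 :=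
  IsHomogeneous.sum _ _ _ fun i _ => isHomogeneous_C_mul_X _ i

lemma exists_eq_linForm {L : MvPolynomial (Fin 3) ℂ} (hL : L.IsHomogeneous 1) :
    ∃ v, L = linForm v := by
  rw [← mem_homogeneousSubmodule, homogeneousSubmodule_one_eq_span_X,
    Submodule.mem_span_range_iff_exists_fun] at hL
  obtain ⟨v, rfl⟩ := hL
  exact ⟨v, by simp [linForm, smul_eq_C_mul]⟩

lemma mul_mem_span_pow_five (v : Fin 5 → Fin 3 → ℂ) :
    linForm (v 0) * linForm (v 1) * linForm (v 2) * linForm (v 3) * linForm (v 4) ∈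
      Submodule.span ℂ (Set.range fun w => linForm w ^ 5) := by
  have hmem : ∀ s₁ s₂ s₃ s₄ : ℂ, (linForm (v 0) + C s₁ * linForm (v 1) + C s₂ * linForm (v 2) +
      C s₃ * linForm (v 3) + C s₄ * linForm (v 4)) ^ 5 ∈
      Submodule.span ℂ (Set.range fun w => linForm w ^ 5) := fun s₁ s₂ s₃ s₄ =>
    Submodule.subset_span ⟨v 0 + s₁ • v 1 + s₂ • v 2 + s₃ • v 3 + s₄ • v 4, by
      simp only [linForm_add, linForm_smul]⟩
  -- Polarization over four signs, the first being fixed since the degree is odd; `1920 = 2⁴ · 5!`.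
  have key : linForm (v 0) * linForm (v 1) * linForm (v 2) * linForm (v 3) * linForm (v 4) =
      (1 / 1920 : ℂ) • ∑ s₁ : Fin 2, ∑ s₂ : Fin 2, ∑ s₃ : Fin 2, ∑ s₄ : Fin 2,
        (![1, -1] s₁ * ![1, -1] s₂ * ![1, -1] s₃ * ![1, -1] s₄ : ℂ) •
        (linForm (v 0) + C (![1, -1] s₁) * linForm (v 1) + C (![1, -1] s₂) * linForm (v 2) +
          C (![1, -1] s₃) * linForm (v 3) + C (![1, -1] s₄) * linForm (v 4)) ^ 5 := by
    refine MvPolynomial.funext fun x => ?_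
    simp only [Fin.sum_univ_two, Matrix.cons_val_zero, Matrix.cons_val_one, smul_eval, map_add,
      map_mul, map_pow, eval_C, eval_linForm]
    ring
  rw [key]
  exact Submodule.smul_mem _ _ <| Submodule.sum_mem _ fun _ _ => Submodule.sum_mem _ fun _ _ =>
    Submodule.sum_mem _ fun _ _ => Submodule.sum_mem _ fun _ _ =>
      Submodule.smul_mem _ _ (hmem _ _ _ _)

theorem exists_sum_linForm_pow {F : MvPolynomial (Fin 3) ℂ} (hF : F.IsHomogeneous 5) :
    ∃ (S : Finset (Fin 3 → ℂ)) (c : S → ℂ), F = ∑ i, c i • linForm (i : Fin 3 → ℂ) ^ 5 := by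
  have h : F ∈ Submodule.span ℂ (Set.range fun w => linForm w ^ 5) := by
    rw [← mem_homogeneousSubmodule, ← homogeneousSubmodule_one_pow,
      Submodule.pow_eq_span_pow_set] at hF
    refine Submodule.span_le.2 ?_ hF
    intro P hP
    obtain ⟨f, rfl⟩ := Set.mem_pow.1 hP
    choose v hv using fun i => exists_eq_linForm (f i).2
    simpa [List.ofFn_succ, hv, mul_assoc] using mul_mem_span_pow_five v
  rw [Finsupp.mem_span_range_iff_exists_finsupp] at h
  obtain ⟨c, rfl⟩ := h
  exact ⟨c.support, fun i => c i, (Finset.sum_coe_sort c.support fun w => c w • linForm w ^ 5).symm⟩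

/-! ### The first concomitant of degree four forces all points of the curve to be singular -/

/-- The Cauchy–Binet identity for `(a × b) · (x × y)`. -/
lemma det3_cross (a b x y : Fin 3 → ℂ) : det3 a b (crossProduct x y) =
    a ⬝ᵥ x * b ⬝ᵥ y - b ⬝ᵥ x * a ⬝ᵥ y := by
  simp only [det3, Matrix.det_fin_three, Matrix.of_apply, Matrix.cons_val, cross_apply, dotProduct,
    Fin.sum_univ_three]
  ring

lemma eval_pderiv_sum_linForm {ι : Type*} [Fintype ι] (c : ι → ℂ) (l : ι → Fin 3 → ℂ)
    (x : Fin 3 → ℂ) (j : Fin 3) :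
    eval x (pderiv j (∑ i, c i • linForm (l i) ^ 5)) =
      5 * ∑ i, c i * ((l i ⬝ᵥ x) ^ 4 * l i j) := by
  have h : ∀ v : Fin 3 → ℂ, pderiv j (linForm v) = C (v j) := fun v => by
    simp [linForm, pderiv_X, Pi.single_apply]
  simp only [map_sum, Derivation.map_smul, pderiv_pow, h, smul_eval, map_mul, map_pow,
    eval_linForm, eval_C, map_natCast, Finset.mul_sum]
  exact Finset.sum_congr rfl fun i _ => by push_cast; ring

/-- With `a = lᵢ(x)` and `b = lᵢ(y)`, the hypothesis says `F(x) = 0`. Expanding the brackets, every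
term containing `∑ c a⁵` drops out, including the one with the second moment `M₂`, and a pure fourth
power of the first moment remains. -/
lemma sum_moment_identity {ι : Type*} [Fintype ι] (c a b : ι → ℂ) (h : ∑ i, c i * a i ^ 5 = 0) :
    ∑ i, c i * (a i * (∑ k, c k * ((a i * b k - a k * b i) * a k ^ 4)) ^ 2 *
      ∑ j, c j * ((a i * b j - a j * b i) ^ 2 * a j ^ 3)) =
      -2 * (∑ i, c i * (a i ^ 4 * b i)) ^ 4 := by
  set M := ∑ i, c i * (a i ^ 4 * b i) with hM
  set M₂ := ∑ i, c i * (a i ^ 3 * b i ^ 2) with hM₂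
  have hA : ∀ i, ∑ k, c k * ((a i * b k - a k * b i) * a k ^ 4) = a i * M := fun i => by
    have : a i * M = a i * M - b i * ∑ k, c k * a k ^ 5 := by rw [h]; ring
    rw [this, hM, Finset.mul_sum, Finset.mul_sum, ← Finset.sum_sub_distrib]
    exact Finset.sum_congr rfl fun k _ => by ring
  have hB : ∀ i, ∑ j, c j * ((a i * b j - a j * b i) ^ 2 * a j ^ 3) =
      a i ^ 2 * M₂ - 2 * a i * b i * M := fun i => by
    have : a i ^ 2 * M₂ - 2 * a i * b i * M =
        a i ^ 2 * M₂ - 2 * a i * b i * M + b i ^ 2 * ∑ k, c k * a k ^ 5 := by rw [h]; ring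
    rw [this, hM, hM₂, Finset.mul_sum, Finset.mul_sum, Finset.mul_sum, ← Finset.sum_sub_distrib,
      ← Finset.sum_add_distrib]
    exact Finset.sum_congr rfl fun k _ => by ring
  calc _ = ∑ i, (M ^ 2 * M₂ * (c i * a i ^ 5) - 2 * M ^ 3 * (c i * (a i ^ 4 * b i))) :=
        Finset.sum_congr rfl fun i _ => by rw [hA, hB]; ring
    _ = M ^ 2 * M₂ * 0 - 2 * M ^ 3 * M := by
        rw [Finset.sum_sub_distrib, ← Finset.mul_sum, ← Finset.mul_sum, h]
    _ = -2 * M ^ 4 := by ring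

theorem eval_pderiv_eq_zero_of_cov4 {F : MvPolynomial (Fin 3) ℂ} (hF : F.IsHomogeneous 5)
    (h : 50 * concomitant !![5, 3, 4, 4; 0, 2, 1, 1] F
      - 19 * concomitant !![5, 1, 5, 5; 0, 4, 0, 0] F = 0)
    {x : Fin 3 → ℂ} (hx : eval x F = 0) (j : Fin 3) : eval x (pderiv j F) = 0 := by
  obtain ⟨S, c, rfl⟩ := exists_sum_linForm_pow hF
  rw [eval_pderiv_sum_linForm]
  -- Along this basis vector the first moment is one fifth of the `j`-th partial derivative at `x`.
  set y : Fin 3 → ℂ := Pi.single j 1 with hy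
  have hyj : ∀ v : Fin 3 → ℂ, v j = v ⬝ᵥ y := fun v => by simp [hy]
  have h' := congrArg (eval (Sum.elim x (crossProduct x y))) h
  rw [map_sub, map_mul, map_mul,
    eval_concomitant_5344_0211 (fun i j => det3_cross _ _ x y) (fun i => rfl),
    eval_concomitant_5155_0400 (fun i j => det3_cross _ _ x y) (fun i => rfl)] at h'
  simp only [hyj]
  have h0 : ∑ i, c i * ((i : Fin 3 → ℂ) ⬝ᵥ x) ^ 5 = 0 := by
    rw [← hx]; simp [eval_linForm]
  rw [sum_moment_identity c _ _ h0] at h'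
  simp only [h0, map_ofNat, map_zero, ne_eq, OfNat.ofNat_ne_zero, not_false_eq_true, zero_pow,
    mul_zero, zero_mul, Finset.sum_const_zero, sub_zero] at h'
  simpa using h'

/-! ### Forms all of whose zeros are singular -/

lemma totalDegree_pow_of_isDomain {σ R : Type*} [CommRing R] [IsDomain R] {p : MvPolynomial σ R}
    (hp : p ≠ 0) (n : ℕ) : (p ^ n).totalDegree = n * p.totalDegree := by
  induction n with
  | zero => simp
  | succ n ih => rw [pow_succ, totalDegree_mul_of_isDomain (pow_ne_zero n hp) hp, ih]; ring

lemma totalDegree_prod_of_isDomain {σ R α : Type*} [CommRing R] [IsDomain R] (s : Finset α)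
    {f : α → MvPolynomial σ R} (hf : ∀ i ∈ s, f i ≠ 0) :
    (∏ i ∈ s, f i).totalDegree = ∑ i ∈ s, (f i).totalDegree := by
  classical
  induction s using Finset.induction_on with
  | empty => simp
  | insert a s ha ih =>
    rw [Finset.prod_insert ha, Finset.sum_insert ha, totalDegree_mul_of_isDomain
      (hf a (Finset.mem_insert_self a s))
      (Finset.prod_ne_zero_iff.2 fun i hi => hf i (Finset.mem_insert_of_mem hi)),
      ih fun i hi => hf i (Finset.mem_insert_of_mem hi)]

lemma totalDegree_pos_of_irreducible {σ k : Type*} [Field k] {P : MvPolynomial σ k}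
    (hP : Irreducible P) : 0 < P.totalDegree := by
  by_contra h
  have h0 : P = C (coeff 0 P) := totalDegree_eq_zero_iff_eq_C.1 (by omega)
  refine hP.not_isUnit ?_
  rw [h0]
  refine IsUnit.map C (isUnit_iff_ne_zero.2 fun h1 => hP.ne_zero ?_)
  rw [h0, h1, C_0]

lemma totalDegree_pderiv_lt {σ R : Type*} [CommRing R] {P : MvPolynomial σ R} {j : σ}
    (h : pderiv j P ≠ 0) : (pderiv j P).totalDegree < P.totalDegree := by
  have hs : (pderiv j P).support.Nonempty := Finset.nonempty_iff_ne_empty.2 (by simpa using h)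
  obtain ⟨m, hm, hmax⟩ := Finset.exists_mem_eq_sup _ hs fun m : σ →₀ ℕ => m.sum fun _ e => e
  have hm' : m + Finsupp.single j 1 ∈ P.support := by
    rw [mem_support_iff, coeff_pderiv] at hm
    exact mem_support_iff.2 (left_ne_zero_of_mul hm)
  have h1 := le_totalDegree hm'
  rw [Finsupp.sum_add_index' (fun _ => rfl) (fun _ _ _ => rfl), Finsupp.sum_single_index rfl] at h1
  rw [totalDegree, hmax]
  omega

lemma eq_C_of_pderiv_eq_zero {σ k : Type*} [Field k] [CharZero k] {P : MvPolynomial σ k}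
    (h : ∀ j, pderiv j P = 0) : P = C (coeff 0 P) := by
  refine totalDegree_eq_zero_iff_eq_C.1 ((totalDegree_eq_zero_iff _ P).2 fun m hm j => ?_)
  by_contra hj
  have h1 := congrArg (coeff (m - Finsupp.single j 1)) (h j)
  have h2 : m - Finsupp.single j 1 + Finsupp.single j 1 = m :=
    tsub_add_cancel_of_le (by simpa using Nat.one_le_iff_ne_zero.2 hj)
  rw [coeff_pderiv, h2, coeff_zero, mul_eq_zero] at h1
  exact h1.elim (mem_support_iff.1 hm) (Nat.cast_add_one_ne_zero _)

/-- If `P` divided `F = PQ` only once, then `P ∣ ∂F` would give `P ∣ ∂P` for every partial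
derivative. By degree all of them vanish, and in characteristic zero `P` would be constant. -/
lemma sq_dvd_of_irreducible_dvd {σ k : Type*} [Finite σ] [Field k] [IsAlgClosed k] [CharZero k]
    {F P : MvPolynomial σ k}
    (hF : ∀ x, eval x F = 0 → ∀ j, eval x (pderiv j F) = 0) (hP : Irreducible P) (hPF : P ∣ F) :
    P ^ 2 ∣ F := by
  obtain ⟨Q, rfl⟩ := hPF
  have hprime : Prime P := hP.prime
  rw [sq]
  refine mul_dvd_mul_left P ?_
  by_contra hQ
  have hd : ∀ j, pderiv j P = 0 := by
    intro j
    -- Nullstellensatz: the derivative vanishes on the zero locus of `F`.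
    have h1 : pderiv j (P * Q) ∈ (Ideal.span {P * Q}).radical := by
      rw [← vanishingIdeal_zeroLocus_eq_radical (K := k), mem_vanishingIdeal_iff]
      intro x hx
      rw [aeval_eq_eval]
      exact hF x (by simpa [aeval_eq_eval] using hx (P * Q) (Ideal.mem_span_singleton_self _)) j
    obtain ⟨n, hn⟩ := h1
    rw [Ideal.mem_span_singleton] at hn
    have h2 : P ∣ pderiv j (P * Q) := hprime.dvd_of_dvd_pow ((dvd_mul_right P Q).trans hn)
    rw [pderiv_mul, dvd_add_left (dvd_mul_right P _)] at h2
    have h3 : P ∣ pderiv j P := (hprime.dvd_or_dvd h2).resolve_right hQ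
    by_contra h0
    exact absurd (totalDegree_le_of_dvd_of_isDomain h3 h0) (not_le.2 (totalDegree_pderiv_lt h0))
  have := totalDegree_pos_of_irreducible hP
  rw [eq_C_of_pderiv_eq_zero hd, totalDegree_C] at this
  exact lt_irrefl _ this

/-- The degree is `5 = ∑ eᵢ dᵢ` with multiplicities `eᵢ ≥ 2` and factor degrees `dᵢ ≥ 1`. At most
two distinct factors fit, and the solutions are `5 · 1` and `3 · 1 + 2 · 1`. -/
lemma exists_eq_cube_mul_sq {k : Type*} {σ : Type*} [Field k] {F : MvPolynomial σ k}
    (hdeg : F.totalDegree = 5) (h : ∀ P, Irreducible P → P ∣ F → P ^ 2 ∣ F) :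
    ∃ (r : k) (P Q : MvPolynomial σ k), P.totalDegree = 1 ∧ Q.totalDegree = 1 ∧
      F = C r * (P ^ 3 * Q ^ 2) := by
  classical
  let _ : NormalizationMonoid (MvPolynomial σ k) :=
    UniqueFactorizationMonoid.strongNormalizationMonoid.toNormalizationMonoid
  have hF0 : F ≠ 0 := by rintro rfl; simp at hdeg
  set s := UniqueFactorizationMonoid.normalizedFactors F with hs
  have hirr : ∀ P ∈ s.toFinset, Irreducible P := fun P hP =>
    UniqueFactorizationMonoid.irreducible_of_normalized_factor P (Multiset.mem_toFinset.1 hP)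
  have hcount : ∀ P ∈ s.toFinset, 2 ≤ s.count P := by
    intro P hP
    have hP' := Multiset.mem_toFinset.1 hP
    have h2 := h P (hirr P hP) (UniqueFactorizationMonoid.dvd_of_mem_normalizedFactors hP')
    rw [pow_dvd_iff_le_emultiplicity,
      UniqueFactorizationMonoid.emultiplicity_eq_count_normalizedFactors (hirr P hP) hF0,
      UniqueFactorizationMonoid.normalize_normalized_factor P hP'] at h2
    exact_mod_cast h2
  have hassoc : Associated (∏ P ∈ s.toFinset, P ^ s.count P) F := by
    rw [← Finset.prod_multiset_count]
    exact UniqueFactorizationMonoid.prod_normalizedFactors hF0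
  obtain ⟨v, hv⟩ := hassoc
  obtain ⟨r, hr, hrv⟩ := isUnit_iff_eq_C_of_isReduced.1 v.isUnit
  rw [hrv, mul_comm] at hv
  have hsum : ∑ P ∈ s.toFinset, s.count P * P.totalDegree = 5 := by
    rw [← hdeg, ← hv, totalDegree_mul_of_isDomain (by simpa using hr.ne_zero)
      (Finset.prod_ne_zero_iff.2 fun P hP => pow_ne_zero _ (hirr P hP).ne_zero), totalDegree_C,
      zero_add, totalDegree_prod_of_isDomain _ fun P hP => pow_ne_zero _ (hirr P hP).ne_zero]
    exact Finset.sum_congr rfl fun P hP =>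
      (totalDegree_pow_of_isDomain (hirr P hP).ne_zero _).symm
  have hpos : ∀ P ∈ s.toFinset, 1 ≤ P.totalDegree := fun P hP =>
    totalDegree_pos_of_irreducible (hirr P hP)
  have hcard : s.toFinset.card ≤ 2 := by
    have : ∑ P ∈ s.toFinset, 2 ≤ 5 := by
      rw [← hsum]
      exact Finset.sum_le_sum fun P hP => by nlinarith [hcount P hP, hpos P hP]
    rw [Finset.sum_const, smul_eq_mul] at this
    omega
  generalize s.toFinset = t at *
  interval_cases hc : t.card
  · rw [Finset.card_eq_zero] at hc
    subst hc
    simp at hsum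
  · obtain ⟨P, rfl⟩ := Finset.card_eq_one.1 hc
    rw [Finset.sum_singleton] at hsum
    rw [Finset.prod_singleton] at hv
    have h1 := hcount P (Finset.mem_singleton_self P)
    have h2 := hpos P (Finset.mem_singleton_self P)
    have h3 : s.count P = 5 := by
      have := (Nat.prime_five.eq_one_or_self_of_dvd _ (Dvd.intro _ hsum))
      omega
    rw [h3] at hsum hv
    exact ⟨r, P, P, by omega, by omega, by rw [← hv]; ring⟩
  · obtain ⟨P, Q, hPQ, rfl⟩ := Finset.card_eq_two.1 hc
    rw [Finset.sum_pair hPQ] at hsum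
    rw [Finset.prod_pair hPQ] at hv
    have h1 := hcount P (by simp)
    have h2 := hpos P (by simp)
    have h3 := hcount Q (by simp)
    have h4 := hpos Q (by simp)
    have h5 : P.totalDegree = 1 := by nlinarith
    have h6 : Q.totalDegree = 1 := by nlinarith
    rw [h5, h6] at hsum
    have h7 : s.count P = 3 ∧ s.count Q = 2 ∨ s.count P = 2 ∧ s.count Q = 3 := by omega
    rcases h7 with ⟨h8, h9⟩ | ⟨h8, h9⟩
    · exact ⟨r, P, Q, h5, h6, by rw [← hv, h8, h9]⟩
    · exact ⟨r, Q, P, h6, h5, by rw [← hv, h8, h9]; ring⟩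

lemma exists_eq_linForm_add_C {P : MvPolynomial (Fin 3) ℂ} (hP : P.totalDegree = 1) :
    ∃ v α, P = linForm v + C α := by
  obtain ⟨v, hv⟩ := exists_eq_linForm (homogeneousComponent_isHomogeneous 1 P)
  refine ⟨v, coeff 0 P, ?_⟩
  conv_lhs => rw [← sum_homogeneousComponent P, hP]
  rw [Finset.sum_range_succ, Finset.sum_range_one, homogeneousComponent_zero, hv, add_comm]

lemma eval_smul_of_isHomogeneous {F : MvPolynomial (Fin 3) ℂ} (hF : F.IsHomogeneous 5) (τ : ℂ)
    (x : Fin 3 → ℂ) : eval (τ • x) F = τ ^ 5 * eval x F := by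
  obtain ⟨S, c, rfl⟩ := exists_sum_linForm_pow hF
  simp only [map_sum, smul_eval, map_pow, eval_linForm, dotProduct_smul, smul_eq_mul, mul_pow,
    Finset.mul_sum]
  exact Finset.sum_congr rfl fun i _ => by ring

theorem exists_linForm_of_singular {F : MvPolynomial (Fin 3) ℂ} (hF : F.IsHomogeneous 5)
    (hF0 : F ≠ 0) (h : ∀ x, eval x F = 0 → ∀ j, eval x (pderiv j F) = 0) :
    ∃ (r : ℂ) (v w : Fin 3 → ℂ), F = C r * (linForm v ^ 3 * linForm w ^ 2) := by
  obtain ⟨r, P, Q, hP, hQ, hPQ⟩ := exists_eq_cube_mul_sq (hF.totalDegree hF0) fun P =>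
    sq_dvd_of_irreducible_dvd h
  obtain ⟨v, α, rfl⟩ := exists_eq_linForm_add_C hP
  obtain ⟨w, β, rfl⟩ := exists_eq_linForm_add_C hQ
  refine ⟨r, v, w, MvPolynomial.funext fun x => ?_⟩
  have key : ∀ τ : ℂ, τ ^ 5 * eval x F =
      r * ((τ * v ⬝ᵥ x + α) ^ 3 * (τ * w ⬝ᵥ x + β) ^ 2) := by
    intro τ
    rw [← eval_smul_of_isHomogeneous hF, hPQ]
    simp [eval_linForm]
  simp only [map_mul, map_pow, eval_C, eval_linForm]
  -- The fifth finite difference in `τ`, divided by `5!`, extracts the coefficient of `τ⁵`; this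
  -- discards the constant terms `α` and `β`.
  linear_combination (1 / 120) * (key 6 - 5 * key 5 + 10 * key 4 - 10 * key 3 + 5 * key 2 - key 1)

/-! ### Zero schemes -/

lemma zeroScheme_eq_pow_mul_pow_iff {F L₁ L₂ : MvPolynomial (Fin 3) ℂ} :
    zeroScheme F = zeroScheme L₁ ^ 3 * zeroScheme L₂ ^ 2 ↔
      ∀ i, Associated (dehomogenize i F) (dehomogenize i (L₁ ^ 3 * L₂ ^ 2)) := by
  rw [funext_iff]
  refine forall_congr' fun i => ?_
  rw [Pi.mul_apply, Pi.pow_apply, Pi.pow_apply, zeroScheme, zeroScheme, zeroScheme,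
    Ideal.span_singleton_pow, Ideal.span_singleton_pow, Ideal.span_singleton_mul_span_singleton,
    Ideal.span_singleton_eq_span_singleton, map_mul, map_pow, map_pow]

lemma eval_dehomogenize (i : Fin 3) (F : MvPolynomial (Fin 3) ℂ) {x : Fin 3 → ℂ} (hx : x i = 1) :
    eval (fun j => x j.1) (dehomogenize i F) = eval x F := by
  have h : (eval fun j : {j : Fin 3 // j ≠ i} => x j.1).comp (dehomogenize i).toRingHom =
      eval x := by
    refine MvPolynomial.ringHom_ext (fun c => ?_) fun j => ?_
    · simp [dehomogenize]
    · by_cases hj : j = i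
      · subst hj; simp [dehomogenize, hx]
      · simp [dehomogenize, hj]
  exact congrArg (fun f => f F) h

/-- By scaling, `F` vanishes wherever `xᵢ ≠ 0`, so `xᵢ F` vanishes everywhere. Hence one chart
determines a form of degree five. -/
lemma eq_zero_of_dehomogenize_eq_zero {i : Fin 3} {F : MvPolynomial (Fin 3) ℂ}
    (hF : F.IsHomogeneous 5) (h : dehomogenize i F = 0) : F = 0 := by
  have hz : X i * F = 0 := by
    refine MvPolynomial.funext fun x => ?_
    rw [map_mul, eval_X, map_zero, mul_eq_zero, or_iff_not_imp_left]
    intro hx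
    have h1 : eval ((x i)⁻¹ • x) F = 0 := by
      rw [← eval_dehomogenize i F (by simp [hx]), h, map_zero]
    rw [eval_smul_of_isHomogeneous hF] at h1
    exact (mul_eq_zero.1 h1).resolve_left (pow_ne_zero _ (inv_ne_zero hx))
  exact (mul_eq_zero.1 hz).resolve_left (X_ne_zero i)

lemma exists_linForm_of_isTripleLinePlusDoubleLine {F : MvPolynomial (Fin 3) ℂ}
    (hF : F.IsHomogeneous 5) (h : IsTripleLinePlusDoubleLine (zeroScheme F)) :
    ∃ v w : Fin 3 → ℂ, F = linForm v ^ 3 * linForm w ^ 2 := by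
  obtain ⟨L₁, L₂, h₁, -, h₂, -, hC⟩ := h
  obtain ⟨e, he⟩ := zeroScheme_eq_pow_mul_pow_iff.1 hC 0
  obtain ⟨r, hr, her⟩ := isUnit_iff_eq_C_of_isReduced.1 e.isUnit
  have hG : (C r * F - L₁ ^ 3 * L₂ ^ 2).IsHomogeneous 5 :=
    (hF.C_mul r).sub ((h₁.pow 3).mul (h₂.pow 2))
  have hFG : C r * F = L₁ ^ 3 * L₂ ^ 2 := by
    refine sub_eq_zero.1 (eq_zero_of_dehomogenize_eq_zero (i := 0) hG ?_)
    have hr' : dehomogenize 0 (C r) = C r := (dehomogenize 0).commutes r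
    rw [map_sub, map_mul, hr', ← her, ← he, mul_comm, sub_self]
  -- The zero scheme fixes `F` only up to a constant; a cube root absorbs it into the tripled linear
  -- form.
  obtain ⟨d, hd⟩ := IsAlgClosed.exists_pow_nat_eq r⁻¹ (n := 3) (by norm_num)
  obtain ⟨v, rfl⟩ := exists_eq_linForm h₁
  obtain ⟨w, rfl⟩ := exists_eq_linForm h₂
  refine ⟨d • v, w, ?_⟩
  rw [linForm_smul, mul_pow, mul_assoc, ← hFG, ← map_pow, hd, ← mul_assoc, ← C_mul,
    inv_mul_cancel₀ hr.ne_zero, C_1, one_mul]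

lemma isTripleLinePlusDoubleLine_of_eq {F : MvPolynomial (Fin 3) ℂ} (hF0 : F ≠ 0) {r : ℂ}
    {v w : Fin 3 → ℂ} (h : F = C r * (linForm v ^ 3 * linForm w ^ 2)) :
    IsTripleLinePlusDoubleLine (zeroScheme F) := by
  have hr : r ≠ 0 := by rintro rfl; simp [h] at hF0
  refine ⟨linForm v, linForm w, isHomogeneous_linForm v, ?_, isHomogeneous_linForm w, ?_,
    zeroScheme_eq_pow_mul_pow_iff.2 fun i => ?_⟩
  · intro hv; simp [h, hv] at hF0
  · intro hw; simp [h, hw] at hF0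
  · have hr' : dehomogenize i (C r) = C r := (dehomogenize i).commutes r
    rw [h, map_mul, hr']
    exact associated_unit_mul_left _ _ ((isUnit_iff_ne_zero.2 hr).map C)

end TernaryQuintic

end

theorem mainTheorem10 (F : MvPolynomial (Fin 3) ℂ) (hF : F.IsHomogeneous 5) (hF0 : F ≠ 0) :
    TernaryQuintic.IsTripleLinePlusDoubleLine (TernaryQuintic.zeroScheme F) ↔
      (∀ Ψ ∈ TernaryQuintic.cov3, Ψ F = 0) ∧ (∀ Ψ ∈ TernaryQuintic.cov4, Ψ F = 0) := by
  constructor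
  · intro h
    obtain ⟨v, w, rfl⟩ := TernaryQuintic.exists_linForm_of_isTripleLinePlusDoubleLine hF h
    exact ⟨TernaryQuintic.cov3_linForm v w, TernaryQuintic.cov4_linForm v w⟩
  · rintro ⟨-, h⟩
    have h4 := h _ (List.mem_cons_self ..)
    obtain ⟨r, v, w, hrvw⟩ := TernaryQuintic.exists_linForm_of_singular hF hF0 fun x hx j =>
      TernaryQuintic.eval_pderiv_eq_zero_of_cov4 hF h4 hx j
    exact TernaryQuintic.isTripleLinePlusDoubleLine_of_eq hF0 hrvw
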